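/- Let $k$ be a field and let $H\subseteq\mathbb{N}$ be a numerical semigroup (a submonoid of $(\mathbb N,+)$ with finite complement) with embedding dimension $n\ge 3$ (the number of minimal generators) and multiplicity $a=\min(H\setminus\{0\})$. Put $\ell=a-n+1$, so that $a=\ell+n-1$, and assume $\ell\ge 2$. Let $\operatorname{PF}(H)$ be the set of integers $x\notin H$ with $x+y\in H$ for all $0<y\in H$, and let $k[H]\subseteq k[t]$ be the $k$-subalgebra generated by all $t^{s}$, $s\in H$. Suppose that * the Artinian local ring $k[H]/(t^{a})$ is stretched, i.e. the square of its maximal ideal is zero or principal; * $\operatorname{PF}(H)=\{h+\alpha,h+2\alpha,\dots,h+(n-1)\alpha\}$ for some integers $h\ge 0$ and $\alpha>0$; * (the case $j=1$) with $b=\frac{h+\alpha+a}{\ell}$, the number $b$ is an integer and $\{a,\,b\}\cup\{h+i\alpha+a \mid 2\le i\le n-1\}$ is the minimal system of generators of $H$. Put $a_1=a$, $a_2=b$ and $a_i=h+(i-1)\alpha+a$ for $3\le i\le n$, and let $I_H$ be the kernel of the $k$-algebra homomorphism $k[X_1,\dots,X_n]\to k[H]$, $X_i\mapsto t^{a_i}$.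 Then: 1. $h-(\ell-1)b\equiv 0\pmod a$, and there is an integer $h_1\ge 0$ with $h=h_1a+(\ell-1)b$. 2. For this $h_1$, $$I_H=\operatorname{I}_2\begin{pmatrix} X_1^{h_1+1} & X_2^{\ell} & X_3 & \cdots & X_{n-1} & X_n\\ X_2 & X_3 & X_4 & \cdots & X_n & X_1^{(h_1+1)\ell+\alpha}\end{pmatrix},$$ where $\operatorname{I}_2(M)$ denotes the ideal generated by the $2\times 2$ minors of $M$. -/

import Mathlib

noncomputable section

/-- A numerical semigroup: a submonoid of `ℕ` with finite complement
(equivalently, with greatest common divisor `1`). -/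
def IsNumericalSemigroup (H : AddSubmonoid ℕ) : Prop :=
  ((H : Set ℕ)ᶜ).Finite

/-- `a` lists, without repetition, a minimal system of generators of `H`. In particular the
embedding dimension of `H` is then `n`. -/
def IsMinimalGeneratingSystem (H : AddSubmonoid ℕ) {n : ℕ} (a : Fin n → ℕ) : Prop :=
  Function.Injective a ∧ Minimal (fun A : Set ℕ => AddSubmonoid.closure A = H) (Set.range a)

/-- `m` is the multiplicity of `H`, the least nonzero element of `H`. -/
def IsMultiplicity (H : AddSubmonoid ℕ) (m : ℕ) : Prop :=
  IsLeast {x : ℕ | x ∈ H ∧ x ≠ 0} m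

/-- The set `PF(H)` of pseudo-Frobenius numbers: the integers `x ∉ H` such that `x + y ∈ H` for
every `0 < y ∈ H`. -/
def pseudoFrobenius (H : AddSubmonoid ℕ) : Set ℤ :=
  {x : ℤ | (¬ ∃ z ∈ H, (z : ℤ) = x) ∧ ∀ y ∈ H, 0 < y → ∃ z ∈ H, (z : ℤ) = x + (y : ℤ)}

/-- A stretched Artinian local ring: the square of the maximal ideal is zero or principal. -/
def IsStretchedArtinianLocal (A : Type*) [CommRing A] : Prop :=
  IsArtinianRing A ∧ ∃ _ : IsLocalRing A,
    IsLocalRing.maximalIdeal A ^ 2 = ⊥ ∨ (IsLocalRing.maximalIdeal A ^ 2).IsPrincipal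

/-- The semigroup ring `k[t ^ a₁, …, t ^ aₙ] ⊆ k[t]`. -/
def semigroupRing (k : Type*) [Field k] {n : ℕ} (a : Fin n → ℕ) :
    Subalgebra k (Polynomial k) :=
  Algebra.adjoin k (Set.range fun i => (Polynomial.X : Polynomial k) ^ a i)

/-- The element `t ^ aᵢ` of the semigroup ring. -/
def semigroupRing.gen (k : Type*) [Field k] {n : ℕ} (a : Fin n → ℕ) (i : Fin n) :
    semigroupRing k a :=
  ⟨Polynomial.X ^ a i, Algebra.subset_adjoin ⟨i, rfl⟩⟩

/-- The defining ideal: the kernel of `k[X₁, …, Xₙ] → k[t ^ a₁, …, t ^ aₙ]`, `Xᵢ ↦ t ^ aᵢ`. -/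
def definingIdeal (k : Type*) [Field k] {n : ℕ} (a : Fin n → ℕ) :
    Ideal (MvPolynomial (Fin n) k) :=
  RingHom.ker (MvPolynomial.aeval (R := k) (semigroupRing.gen k a))

/-- The ideal generated by the `2 × 2` minors of a `2 × n` matrix. -/
def idealOfMinorsTwo {R : Type*} [CommRing R] {n : ℕ} (M : Matrix (Fin 2) (Fin n) R) : Ideal R :=
  Ideal.span {x : R | ∃ i j : Fin n, i < j ∧ x = (M.submatrix id ![i, j]).det}

/-- The `2 × n` matrix with rows `X₁ ^ q, X₂ ^ l, X₃, …, Xₙ` and `X₂, X₃, …, Xₙ, X₁ ^ p`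
(the variable `Xᵢ` of the text has index `i - 1`). -/
def stretchedMatrix (k : Type*) [Field k] (n q l p : ℕ) :
    Matrix (Fin 2) (Fin n) (MvPolynomial (Fin n) k) :=
  Matrix.of
    ![fun i : Fin n =>
        if i.val = 0 then MvPolynomial.X i ^ q
        else if i.val = 1 then MvPolynomial.X i ^ l
        else MvPolynomial.X i,
      fun i : Fin n =>
        if hi : i.val + 1 < n then MvPolynomial.X ⟨i.val + 1, hi⟩
        else MvPolynomial.X ⟨0, i.pos⟩ ^ p]

end

/-! The Apéry set of `H` with respect to `a` has one element in each residue class, and its maximal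
elements are the pseudo-Frobenius numbers shifted by `a`. Hence it consists of `0, b, …, ℓ b` and
the generators `h + i α + a` for `2 ≤ i ≤ n - 1`. Locating the class of `(ℓ - 1) b + α` in this list
forces `b ≡ α` modulo `a`, and minimality of `h + 2 α + a` forces `b > α`
(`exists_eq_add_mul_of_pseudoFrobenius`). Writing `b = α + (h₁ + 1) a`, the relation `ℓ b = h + α +
a` gives the formula for `h`.

For the ideal, `Xᵢ ↦ t ^ aᵢ` makes the second row of the matrix `t ^ α` times the first, so the
minors lie in the kernel. Conversely, modulo the minors every monomial is a power of `X₁` times one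
of `a` monomials, whose degrees `b r`, `r < a`, are distinct modulo `a` (`top_le_span_normalForm`).
These normal forms map to distinct powers of `t`, so the kernel is no larger
(`ker_eq_of_span_eq_top`). -/

/-! ### Apéry sets and the arithmetic of the generators. -/

section Semigroup

/-- The Apéry set of `H` with respect to `a`. -/
def aperySet (H : AddSubmonoid ℕ) (a : ℕ) : Set ℕ :=
  {w | w ∈ H ∧ ∀ z ∈ H, z + a ≠ w}

/-- If `w = v + (c + 1) a`, then `v + c a ∈ H` shows that `w` is not in the Apéry set. -/
lemma eq_of_mem_aperySet_of_modEq {H : AddSubmonoid ℕ} {a v w : ℕ} (ha : a ∈ H)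
    (hv : v ∈ aperySet H a) (hw : w ∈ aperySet H a) (hvw : v ≡ w [MOD a]) : v = w := by
  wlog hle : v ≤ w generalizing v w
  · exact (this hw hv hvw.symm (le_of_not_ge hle)).symm
  obtain ⟨c, hc⟩ := (Nat.modEq_iff_dvd' hle).1 hvw
  cases c with
  | zero => simp at hc; omega
  | succ c =>
    refine absurd ?_ (hw.2 (v + c * a) (H.add_mem hv.1 ?_))
    · rw [Nat.mul_succ, Nat.mul_comm] at hc; omega
    · simpa using H.nsmul_mem ha c

lemma mem_aperySet_of_add_mem {H : AddSubmonoid ℕ} {a v w : ℕ} (hv : v ∈ H) (hw : w ∈ H)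
    (h : v + w ∈ aperySet H a) : v ∈ aperySet H a :=
  ⟨hv, fun z hz e => h.2 (z + w) (H.add_mem hz hw) (by omega)⟩

lemma exists_mem_aperySet_modEq {H : AddSubmonoid ℕ} (hH : IsNumericalSemigroup H) {a : ℕ}
    (ha : 0 < a) (x : ℕ) : ∃ w ∈ aperySet H a, w ≡ x [MOD a] := by
  classical
  obtain ⟨B, hB⟩ := hH.bddAbove
  have hex : ∃ w, w ∈ H ∧ w ≡ x [MOD a] := by
    refine ⟨x + a * (B + 1), ?_, by simp [Nat.ModEq]⟩
    by_contra hn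
    have := hB hn
    nlinarith
  refine ⟨Nat.find hex, ⟨(Nat.find_spec hex).1, fun z hz e => ?_⟩, (Nat.find_spec hex).2⟩
  refine Nat.find_min hex (m := z) (by omega) ⟨hz, ?_⟩
  have := (Nat.find_spec hex).2
  rw [← e] at this
  simpa [Nat.ModEq] using this

lemma aperySet_finite {H : AddSubmonoid ℕ} (hH : IsNumericalSemigroup H) (a : ℕ) :
    (aperySet H a).Finite := by
  obtain ⟨B, hB⟩ := hH.bddAbove
  refine (Set.finite_Iic (B + a)).subset fun w hw => ?_
  by_contra hlt
  simp only [Set.mem_Iic, not_le] at hlt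
  refine hw.2 (w - a) ?_ (by omega)
  by_contra hn
  have := hB hn
  omega

/-- Every element of the Apéry set lies below a maximal one, which is a pseudo-Frobenius number
shifted by `a`. -/
lemma exists_add_sub_mem_pseudoFrobenius {H : AddSubmonoid ℕ} (hH : IsNumericalSemigroup H)
    {a w : ℕ} (hw : w ∈ aperySet H a) :
    ∃ y ∈ H, ((w + y : ℕ) : ℤ) - a ∈ pseudoFrobenius H := by
  have hfin : {m | m ∈ aperySet H a ∧ ∃ y ∈ H, m = w + y}.Finite :=
    (aperySet_finite hH a).subset fun m hm => hm.1
  obtain ⟨m, ⟨hm, y, hy, rfl⟩, hmax⟩ :=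
    hfin.exists_maximal ⟨w, hw, 0, H.zero_mem, rfl⟩
  refine ⟨y, hy, ?_, fun x hx hx0 => ?_⟩
  · rintro ⟨z, hz, e⟩
    exact hm.2 z hz (by omega)
  -- If `w + y + x - a` were not in `H`, then `w + y + x` would be a larger Apéry element above `w`.
  · by_contra hcon
    have := hmax (y := w + y + x) ⟨⟨H.add_mem hm.1 hx, fun z hz e => hcon ⟨z, hz, by omega⟩⟩,
      y + x, H.add_mem hy hx, by ring⟩ (by simp)
    simp at this
    omega

lemma mem_closure_diff_singleton_of_lt {S : Set ℕ} {c x : ℕ}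
    (hx : x ∈ AddSubmonoid.closure S) (hlt : x < c) : x ∈ AddSubmonoid.closure (S \ {c}) := by
  induction hx using AddSubmonoid.closure_induction with
  | mem x hx => exact AddSubmonoid.subset_closure ⟨hx, by simp; omega⟩
  | zero => exact zero_mem _
  | add x y _ _ ihx ihy => exact add_mem (ihx (by omega)) (ihy (by omega))

variable {H : AddSubmonoid ℕ} {n : ℕ} {g : Fin n → ℕ}

lemma IsMinimalGeneratingSystem.mem (hgen : IsMinimalGeneratingSystem H g) (i : Fin n) :
    g i ∈ H := by
  rw [← hgen.2.prop]
  exact AddSubmonoid.subset_closure ⟨i, rfl⟩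

lemma IsMinimalGeneratingSystem.notMem_closure_diff (hgen : IsMinimalGeneratingSystem H g)
    (i : Fin n) : g i ∉ AddSubmonoid.closure (Set.range g \ {g i}) := by
  intro hmem
  have hcl : AddSubmonoid.closure (Set.range g \ {g i}) = H := by
    rw [← hgen.2.prop]
    refine le_antisymm (AddSubmonoid.closure_mono Set.sdiff_subset)
      (AddSubmonoid.closure_le.2 fun x hx => ?_)
    by_cases hxi : x = g i
    · rwa [hxi]
    · exact AddSubmonoid.subset_closure ⟨hx, hxi⟩
  exact (hgen.2.le_of_le hcl Set.sdiff_subset ⟨i, rfl⟩).2 rfl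

/-- A minimal generator is not a sum of two nonzero elements. -/
lemma IsMinimalGeneratingSystem.eq_zero_or_eq_zero (hgen : IsMinimalGeneratingSystem H g)
    (i : Fin n) {x y : ℕ} (hx : x ∈ H) (hy : y ∈ H) (h : x + y = g i) : x = 0 ∨ y = 0 := by
  by_contra! hne
  refine hgen.notMem_closure_diff i ?_
  rw [← hgen.2.prop] at hx hy
  exact h ▸ add_mem (mem_closure_diff_singleton_of_lt hx (by omega))
    (mem_closure_diff_singleton_of_lt hy (by omega))

lemma IsNumericalSemigroup.eq_one_of_dvd (hH : IsNumericalSemigroup H) {d : ℕ}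
    (hd : ∀ x ∈ H, d ∣ x) : d = 1 := by
  obtain ⟨B, hB⟩ := hH.bddAbove
  have hmem : ∀ x, B < x → x ∈ H := fun x hx => by
    by_contra hn
    exact absurd (hB hn) (by omega)
  have h1 := hd _ (hmem (B + 1) (by omega))
  have h2 := hd _ (hmem (B + 1 + 1) (by omega))
  exact Nat.dvd_one.1 ((Nat.dvd_add_right h1).1 h2)

/-- If the Apéry set consists of `0, b, …, ℓ b` and minimal generators `ℓ b + i α`, then `b`
exceeds `α` by a positive multiple of `a`. -/
lemma exists_eq_add_mul_of_pseudoFrobenius (hn : 3 ≤ n) (hH : IsNumericalSemigroup H)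
    {ℓ h α a b : ℕ} (hℓ : 2 ≤ ℓ) (hα : 0 < α) (ha : 0 < a) (hb : ℓ * b = h + α + a)
    (hg : ∀ i : Fin n, g i =
      if i.val = 0 then a else if i.val = 1 then b else h + i.val * α + a)
    (hgen : IsMinimalGeneratingSystem H g)
    (hPF : pseudoFrobenius H =
      {x : ℤ | ∃ i : ℕ, 1 ≤ i ∧ i ≤ n - 1 ∧ x = (h : ℤ) + (i : ℤ) * (α : ℤ)}) :
    ∃ q, b = α + (q + 1) * a := by
  have haH : a ∈ H := by simpa [hg] using hgen.mem ⟨0, by omega⟩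
  have hbH : b ∈ H := by simpa [hg] using hgen.mem ⟨1, by omega⟩
  have hmul : ∀ j, j * b ∈ H := fun j => by simpa using H.nsmul_mem hbH j
  have hb0 : 0 < b := Nat.pos_of_ne_zero fun h0 => by simp [h0] at hb; omega
  have hcH : ∀ i, 2 ≤ i → ∀ hi : i < n, g ⟨i, hi⟩ = h + i * α + a := fun i h2 hi => by
    rw [hg, if_neg (by simp; omega), if_neg (by simp; omega)]
  have hc : ∀ i, 1 ≤ i → i < n → h + i * α + a ∈ aperySet H a := by
    intro i h1 hi
    refine ⟨?_, fun z hz e => ?_⟩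
    · rcases Nat.lt_or_ge i 2 with h2 | h2
      · obtain rfl : i = 1 := by omega
        rw [one_mul, ← hb]
        exact hmul ℓ
      · rw [← hcH i h2 hi]
        exact hgen.mem _
    · have : (h : ℤ) + i * α ∈ pseudoFrobenius H := by
        rw [hPF]
        exact ⟨i, h1, by omega, rfl⟩
      refine this.1 ⟨z, hz, ?_⟩
      have e' : (z : ℤ) + a = h + i * α + a := by exact_mod_cast e
      linarith
  have hℓb : ℓ * b ∈ aperySet H a := by
    rw [hb]
    simpa using hc 1 le_rfl (by omega)
  have hjb : ∀ j, j ≤ ℓ → j * b ∈ aperySet H a := fun j hj => by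
    refine mem_aperySet_of_add_mem (hmul j) (hmul (ℓ - j)) ?_
    rwa [← add_mul, Nat.add_sub_cancel' hj]
  -- A summand `a` would remove `ℓ b` from the Apéry set, and the generators `h + i α + a` with `i ≥
  -- 2` exceed `ℓ b`; only `b` is left.
  have hbelow : ∀ w ∈ H, ∀ y ∈ H, w + y = ℓ * b → ∃ j, w = j * b := by
    intro w hw
    rw [← hgen.2.prop] at hw
    induction hw using AddSubmonoid.closure_induction with
    | mem x hx =>
      obtain ⟨i, rfl⟩ := hx
      intro y hy e
      rw [hg] at e ⊢
      split_ifs at e ⊢ with h0 h1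
      · exact absurd (by omega) (hℓb.2 y hy)
      · exact ⟨1, by simp⟩
      · have : 2 * α ≤ i.val * α := Nat.mul_le_mul_right _ (by omega)
        omega
    | zero => exact fun _ _ _ => ⟨0, by simp⟩
    | add x x' hx hx' ihx ihx' =>
      rw [hgen.2.prop] at hx hx'
      intro y hy e
      obtain ⟨j, hj⟩ := ihx (x' + y) (H.add_mem hx' hy) (by omega)
      obtain ⟨j', hj'⟩ := ihx' (x + y) (H.add_mem hx hy) (by omega)
      exact ⟨j + j', by rw [hj, hj']; ring⟩
  -- Each `w` lies below some `h + i α + a`. For `i = 1` this is `ℓ b`; for `i ≥ 2` it is a minimal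
  -- generator, so `w` is zero or equal to it.
  have hclass : ∀ w ∈ aperySet H a, (∃ j < ℓ, w = j * b) ∨
      ∃ i, 1 ≤ i ∧ i < n ∧ w = h + i * α + a := by
    intro w hw
    obtain ⟨y, hy, hwy⟩ := exists_add_sub_mem_pseudoFrobenius hH hw
    rw [hPF] at hwy
    obtain ⟨i, h1, hi, e⟩ := hwy
    rw [← Nat.cast_mul] at e
    have e' : w + y = h + i * α + a := by omega
    rcases Nat.lt_or_ge i 2 with h2 | h2
    · obtain rfl : i = 1 := by omega
      obtain ⟨j, rfl⟩ := hbelow w hw.1 y hy (by omega)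
      have : j ≤ ℓ := by
        refine Nat.le_of_mul_le_mul_right ?_ hb0
        omega
      rcases this.lt_or_eq with hlt | rfl
      · exact Or.inl ⟨j, hlt, rfl⟩
      · exact Or.inr ⟨1, le_rfl, by omega, by omega⟩
    · rw [← hcH i h2 (by omega)] at e'
      rcases hgen.eq_zero_or_eq_zero _ hw.1 hy e' with h0 | h0
      · exact Or.inl ⟨0, by omega, by simp [h0]⟩
      · exact Or.inr ⟨i, h1, by omega, by rw [← hcH i h2 (by omega)]; omega⟩
  have hc2 : ∀ s j, h + 2 * α + a ≠ s * a + (j + 1) * b := by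
    intro s j e
    refine hgen.notMem_closure_diff ⟨2, by omega⟩ ?_
    have hmem : ∀ i : Fin n, i.val < 2 → ∀ c : ℕ,
        c * g i ∈ AddSubmonoid.closure (Set.range g \ {g ⟨2, by omega⟩}) := by
      intro i hi c
      have hne : g i ≠ g ⟨2, by omega⟩ := fun he => by
        have := congrArg Fin.val (hgen.1 he)
        simp at this
        omega
      have hi : g i ∈ Set.range g \ {g ⟨2, by omega⟩} := ⟨Set.mem_range_self i, hne⟩
      simpa using nsmul_mem (AddSubmonoid.subset_closure hi) c
    have h0 := hmem ⟨0, by omega⟩ (by simp) s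
    have h1 := hmem ⟨1, by omega⟩ (by simp) (j + 1)
    have := add_mem h0 h1
    rwa [show g ⟨0, by omega⟩ = a by simp [hg], show g ⟨1, by omega⟩ = b by simp [hg], ← e,
      ← hcH 2 le_rfl (by omega)] at this
  -- From here on `ℓ` is one less than in the statement. The class of `ℓ b + α` is useful because
  -- adding `b` gives `h + 2 α + a`, while removing `α` gives `ℓ b`.
  obtain ⟨ℓ, rfl⟩ : ∃ m, ℓ = m + 1 := ⟨ℓ - 1, by omega⟩
  have hℓb1 : (ℓ + 1) * b = ℓ * b + b := by ring
  obtain ⟨w, hw, hwx⟩ := exists_mem_aperySet_modEq hH ha (ℓ * b + α)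
  have hmod : b ≡ α [MOD a] := by
    rcases hclass w hw with ⟨j, hj, rfl⟩ | ⟨i, h1, hi, rfl⟩
    · have hcong : (j + 1) * b ≡ h + 2 * α + a [MOD a] := by
        have := hwx.add_right b
        rwa [show j * b + b = (j + 1) * b by ring,
          show ℓ * b + α + b = h + 2 * α + a by omega] at this
      have := eq_of_mem_aperySet_of_modEq haH (hjb (j + 1) (by omega))
        (hc 2 (by omega) (by omega)) hcong
      exact absurd (by omega) (hc2 0 j)
    · obtain ⟨i, rfl⟩ : ∃ m, i = m + 1 := ⟨i - 1, by omega⟩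
      have hi1 : (i + 1) * α = i * α + α := by ring
      have hcong : h + i * α + a ≡ ℓ * b [MOD a] := by
        refine Nat.ModEq.add_right_cancel' α ?_
        rwa [show h + i * α + a + α = h + (i + 1) * α + a by omega]
      rcases Nat.eq_zero_or_pos i with rfl | hi0
      · refine Nat.ModEq.add_left_cancel' (ℓ * b) ?_
        have := hcong.add_right α
        rwa [show h + 0 * α + a + α = ℓ * b + b by omega] at this
      · have := eq_of_mem_aperySet_of_modEq haH (hc i hi0 (by omega)) (hjb ℓ (by omega)) hcong
        have := Nat.mul_le_mul_right α hi0
        omega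
  -- If `α = b + s a`, then `h + 2 α + a = s a + (ℓ + 2) b` would not be a minimal generator.
  rcases le_or_gt b α with hle | hlt
  · obtain ⟨s, hs⟩ := (Nat.modEq_iff_dvd' hle).1 hmod
    refine absurd ?_ (hc2 s (ℓ + 1))
    rw [mul_comm s, show (ℓ + 1 + 1) * b = ℓ * b + b + b by ring]
    omega
  · obtain ⟨s, hs⟩ := (Nat.modEq_iff_dvd' hlt.le).1 hmod.symm
    cases s with
    | zero => simp at hs; omega
    | succ s => exact ⟨s, by rw [mul_comm (s + 1)]; omega⟩

end Semigroup

/-! ### Normal forms modulo the minors, and a criterion for the kernel. -/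

section NormalForm

/-- The elements `x ^ e * z ^ r` for `r < ℓ` and `x ^ e * u (r - ℓ)` for `ℓ ≤ r`. -/
def normalForm {A : Type*} [CommRing A] (x z : A) (u : ℕ → A) (ℓ e r : ℕ) : A :=
  x ^ e * if r < ℓ then z ^ r else u (r - ℓ)

lemma map_normalForm {A B F : Type*} [CommRing A] [CommRing B] [FunLike F A B]
    [RingHomClass F A B] (f : F) (x z : A) (u : ℕ → A) (ℓ e r : ℕ) :
    f (normalForm x z u ℓ e r) = normalForm (f x) (f z) (fun i => f (u i)) ℓ e r := by
  unfold normalForm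
  split_ifs <;> simp

variable {A : Type*} [CommRing A] {x z : A} {u : ℕ → A} {ℓ m p q : ℕ}

/-- If the `2 × 2` minors of the matrix with rows `x ^ q, u 0, …, u (m - 1)` and `z, u 1, …, u m`
vanish, where `u 0 = z ^ ℓ` and `u m = x ^ p`, then all monomials in `x`, `z` and the `u i` are
normal forms. -/
lemma exists_eq_normalForm_of_mem_closure (hℓ : 0 < ℓ) (hm : 0 < m) (hu0 : u 0 = z ^ ℓ)
    (hum : u m = x ^ p) (hzu : ∀ i < m, x ^ q * u (i + 1) = z * u i)
    (huu : ∀ i < m, ∀ j < m, u i * u (j + 1) = u (i + 1) * u j) {y : A}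
    (hy : y ∈ Submonoid.closure ({x, z} ∪ {v | ∃ i < m, v = u i})) :
    ∃ e, ∃ r < ℓ + m, y = normalForm x z u ℓ e r := by
  let P : A → Prop := fun y => ∃ e, ∃ r < ℓ + m, y = normalForm x z u ℓ e r
  have hpow : ∀ e, ∀ r < ℓ, P (x ^ e * z ^ r) := fun e r hr =>
    ⟨e, r, by omega, by simp [normalForm, hr]⟩
  have hgen : ∀ e, ∀ i < m, P (x ^ e * u i) := fun e i hi =>
    ⟨e, ℓ + i, by omega, by simp [normalForm]⟩
  have hcases : ∀ y, P y → (∃ e, ∃ r < ℓ, y = x ^ e * z ^ r) ∨ ∃ e, ∃ i < m, y = x ^ e * u i := by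
    rintro y ⟨e, r, hr, rfl⟩
    unfold normalForm
    split_ifs with h
    · exact Or.inl ⟨e, r, h, rfl⟩
    · exact Or.inr ⟨e, r - ℓ, by omega, rfl⟩
  have hx : ∀ c y, P y → P (x ^ c * y) := by
    rintro c y ⟨e, r, hr, rfl⟩
    exact ⟨c + e, r, hr, by simp [normalForm, pow_add, mul_assoc]⟩
  have hu : ∀ e, ∀ i ≤ m, P (x ^ e * u i) := by
    intro e i hi
    rcases hi.lt_or_eq with hlt | rfl
    · exact hgen e i hlt
    · rw [hum, ← pow_add]
      simpa using hpow (e + p) 0 hℓ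
  -- Multiplication by `z` climbs through the powers of `z` up to `z ^ ℓ = u 0`, then moves `u i` to
  -- `x ^ q * u (i + 1)`.
  have hz : ∀ y, P y → P (z * y) := by
    intro y hy
    rcases hcases y hy with ⟨e, r, hr, rfl⟩ | ⟨e, i, hi, rfl⟩
    · rcases (Nat.succ_le_of_lt hr).lt_or_eq with hlt | heq
      · rw [show z * (x ^ e * z ^ r) = x ^ e * z ^ (r + 1) by ring]
        exact hpow e (r + 1) hlt
      · rw [show z * (x ^ e * z ^ r) = x ^ e * z ^ (r + 1) by ring, show r + 1 = ℓ from heq, ← hu0]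
        exact hgen e 0 hm
    · rw [show z * (x ^ e * u i) = x ^ e * (z * u i) by ring, ← hzu i hi, ← mul_assoc, ← pow_add]
      exact hu _ _ hi
  have hzpow : ∀ r y, P y → P (z ^ r * y) := by
    intro r
    induction r with
    | zero => simp
    | succ r ih =>
      intro y hy
      rw [pow_succ, mul_assoc]
      exact ih _ (hz y hy)
  -- The minors allow lowering `i` while raising `j`, until one factor is `u 0 = z ^ ℓ` or `u m = x
  -- ^ p`.
  have huk : ∀ i < m, ∀ j < m, P (u i * u j) := by
    intro i
    induction i with
    | zero =>
      intro _ j hj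
      rw [hu0]
      exact hzpow ℓ _ (by simpa using hgen 0 j hj)
    | succ i ih =>
      intro hi j hj
      rw [← huu i (by omega) j hj]
      rcases (Nat.succ_le_of_lt hj).lt_or_eq with hlt | heq
      · exact ih (by omega) _ hlt
      · rw [← Nat.succ_eq_add_one, heq, hum, mul_comm]
        exact hgen p i (by omega)
  have hmul : ∀ i < m, ∀ y, P y → P (u i * y) := by
    intro i hi y hy
    rcases hcases y hy with ⟨e, r, hr, rfl⟩ | ⟨e, j, hj, rfl⟩
    · rw [show u i * (x ^ e * z ^ r) = z ^ r * (x ^ e * u i) by ring]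
      exact hzpow r _ (hgen e i hi)
    · rw [mul_left_comm]
      exact hx e _ (huk i hi j hj)
  induction hy using Submonoid.closure_induction_left with
  | one => simpa using hpow 0 0 hℓ
  | mul_left v hv y _ ih =>
    rcases hv with (rfl | rfl) | ⟨i, hi, rfl⟩
    · simpa using hx 1 y ih
    · exact hz y ih
    · exact hmul i hi y ih

end NormalForm

/-- An ideal contained in the kernel of `φ` is the whole kernel if the quotient by it is spanned
by elements that `φ` maps to distinct powers of the indeterminate. -/
lemma ker_eq_of_span_eq_top {k R ι : Type*} [Field k] [CommRing R] [Algebra k R]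
    (φ : R →ₐ[k] Polynomial k) {J : Ideal R} (hJ : J ≤ RingHom.ker φ) (ν : ι → R) {d : ι → ℕ}
    (hd : Function.Injective d) (hφ : ∀ i, φ (ν i) = Polynomial.X ^ d i)
    (hspan : ⊤ ≤ Submodule.span k (Set.range fun i => Ideal.Quotient.mkₐ k J (ν i))) :
    RingHom.ker φ = J := by
  refine le_antisymm (fun f hf => ?_) hJ
  obtain ⟨c, hc⟩ := Finsupp.mem_span_range_iff_exists_finsupp.1
    (hspan (Submodule.mem_top (x := Ideal.Quotient.mkₐ k J f)))
  have hsub : f - c.sum (fun i s => s • ν i) ∈ J := by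
    rw [← Ideal.Quotient.eq_zero_iff_mem, ← Ideal.Quotient.mkₐ_eq_mk k, map_sub, ← hc,
      map_finsuppSum]
    simp only [map_smul, sub_self]
  have hzero : c.sum (fun i s => s • (Polynomial.X : Polynomial k) ^ d i) = 0 := by
    have h1 := hJ hsub
    rw [RingHom.mem_ker] at hf h1
    rw [map_sub, hf, zero_sub, neg_eq_zero, map_finsuppSum] at h1
    simpa only [map_smul, hφ] using h1
  have hind : LinearIndependent k fun i => (Polynomial.X : Polynomial k) ^ d i := by
    have := (Polynomial.basisMonomials k).linearIndependent.comp d hd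
    simpa [Function.comp_def, Polynomial.X_pow_eq_monomial] using this
  have hc0 : c = 0 := (linearIndependent_iff.1 hind) c hzero
  simpa [hc0] using hsub

/-! ### The determinantal ideal as the kernel. -/

section Minors

open MvPolynomial

/-- The entries `X₂ ^ ℓ, X₃, …, Xₙ, X₁ ^ p` of the matrix `stretchedMatrix`. -/
noncomputable def stretchedEntry (k : Type*) [Field k] (n ℓ p : ℕ) (hn : 3 ≤ n) (i : ℕ) :
    MvPolynomial (Fin n) k :=
  if i = 0 then X ⟨1, by omega⟩ ^ ℓ
  else if hi : i + 1 < n then X ⟨i + 1, hi⟩ else X ⟨0, by omega⟩ ^ p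

variable {k : Type*} [Field k] {n q ℓ p : ℕ}

/-- Apart from the first column, both rows are stretches of the single sequence `stretchedEntry`,
shifted by one; this removes the case distinctions from the minors. -/
lemma stretchedMatrix_zero_apply (hn : 3 ≤ n) (i : Fin n) :
    stretchedMatrix k n q ℓ p 0 i =
      if i.val = 0 then X ⟨0, by omega⟩ ^ q else stretchedEntry k n ℓ p hn (i.val - 1) := by
  obtain ⟨i, hi⟩ := i
  rcases i with _ | _ | i
  · simp [stretchedMatrix]
  · simp [stretchedMatrix, stretchedEntry]
  · simp [stretchedMatrix, stretchedEntry, hi]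

lemma stretchedMatrix_one_apply (hn : 3 ≤ n) (i : Fin n) :
    stretchedMatrix k n q ℓ p 1 i =
      if i.val = 0 then X ⟨1, by omega⟩ else stretchedEntry k n ℓ p hn i.val := by
  obtain ⟨i, hi⟩ := i
  rcases i with _ | i
  · simp [stretchedMatrix, show 1 < n by omega]
  · simp [stretchedMatrix, stretchedEntry]

lemma minor_mem_idealOfMinorsTwo {R : Type*} [CommRing R] (M : Matrix (Fin 2) (Fin n) R)
    (i j : Fin n) : M 0 i * M 1 j - M 1 i * M 0 j ∈ idealOfMinorsTwo M := by
  have key : ∀ i j : Fin n, i < j → M 0 i * M 1 j - M 1 i * M 0 j ∈ idealOfMinorsTwo M := by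
    intro i j hij
    refine Ideal.subset_span ⟨i, j, hij, ?_⟩
    simp [Matrix.det_fin_two]
    ring
  rcases lt_trichotomy i j with h | rfl | h
  · exact key i j h
  · simp [mul_comm]
  · rw [← neg_mem_iff]
    convert key j i h using 1
    ring

lemma mk_mul_stretchedEntry_succ (hn : 3 ≤ n) {i : ℕ} (hi : i < n - 1) :
    Ideal.Quotient.mk (idealOfMinorsTwo (stretchedMatrix k n q ℓ p))
        (X ⟨0, by omega⟩ ^ q * stretchedEntry k n ℓ p hn (i + 1)) =
      Ideal.Quotient.mk _ (X ⟨1, by omega⟩ * stretchedEntry k n ℓ p hn i) := by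
  rw [Ideal.Quotient.eq]
  simpa [stretchedMatrix_zero_apply hn, stretchedMatrix_one_apply hn] using
    minor_mem_idealOfMinorsTwo (stretchedMatrix k n q ℓ p) ⟨0, by omega⟩ ⟨i + 1, by omega⟩

lemma mk_stretchedEntry_mul_succ (hn : 3 ≤ n) {i j : ℕ} (hi : i < n - 1) (hj : j < n - 1) :
    Ideal.Quotient.mk (idealOfMinorsTwo (stretchedMatrix k n q ℓ p))
        (stretchedEntry k n ℓ p hn i * stretchedEntry k n ℓ p hn (j + 1)) =
      Ideal.Quotient.mk _ (stretchedEntry k n ℓ p hn (i + 1) * stretchedEntry k n ℓ p hn j) := by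
  rw [Ideal.Quotient.eq]
  simpa [stretchedMatrix_zero_apply hn, stretchedMatrix_one_apply hn] using
    minor_mem_idealOfMinorsTwo (stretchedMatrix k n q ℓ p) ⟨i + 1, by omega⟩ ⟨j + 1, by omega⟩

/-- Modulo the minors, the polynomial ring is spanned by normal forms. -/
lemma top_le_span_normalForm (hn : 3 ≤ n) (hℓ : 0 < ℓ) :
    ⊤ ≤ Submodule.span k (Set.range fun s : ℕ × Fin (ℓ + (n - 1)) =>
      Ideal.Quotient.mkₐ k (idealOfMinorsTwo (stretchedMatrix k n q ℓ p))
        (normalForm (X ⟨0, by omega⟩) (X ⟨1, by omega⟩) (stretchedEntry k n ℓ p hn) ℓ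
          s.1 s.2)) := by
  set J := idealOfMinorsTwo (stretchedMatrix k n q ℓ p) with hJ
  set π := Ideal.Quotient.mkₐ k J with hπ
  have hrange : Set.range (X : Fin n → MvPolynomial (Fin n) k) ⊆
      {X ⟨0, by omega⟩, X ⟨1, by omega⟩} ∪ {v | ∃ i < n - 1, v = stretchedEntry k n ℓ p hn i} := by
    rintro _ ⟨⟨i, hi⟩, rfl⟩
    rcases i with _ | _ | i
    · simp
    · simp
    · exact Or.inr ⟨i + 1, by omega, by simp [stretchedEntry, hi]⟩
  have htop : Algebra.adjoin k (π '' Set.range X) = ⊤ := by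
    rw [← AlgHom.map_adjoin, MvPolynomial.adjoin_range_X, Algebra.map_top,
      AlgHom.range_eq_top]
    exact Ideal.Quotient.mkₐ_surjective k J
  rw [← Algebra.top_toSubmodule, ← htop, Algebra.adjoin_eq_span]
  refine Submodule.span_mono fun y hy => ?_
  have hsub : π '' Set.range X ⊆ {π (X ⟨0, by omega⟩), π (X ⟨1, by omega⟩)} ∪
      {v | ∃ i < n - 1, v = π (stretchedEntry k n ℓ p hn i)} := by
    rintro _ ⟨v, hv, rfl⟩
    rcases hrange hv with (rfl | rfl) | ⟨i, hi, rfl⟩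
    · simp
    · simp
    · exact Or.inr ⟨i, hi, rfl⟩
  obtain ⟨e, r, hr, rfl⟩ := exists_eq_normalForm_of_mem_closure (p := p) (q := q)
    (u := fun i => π (stretchedEntry k n ℓ p hn i)) hℓ (show 0 < n - 1 by omega)
    (by simp [stretchedEntry])
    (by simp [stretchedEntry, show n - 1 + 1 = n by omega, show n - 1 ≠ 0 by omega])
    (fun i hi => by simpa using! mk_mul_stretchedEntry_succ hn hi)
    (fun i hi j hj => by simpa using! mk_stretchedEntry_mul_succ hn hi hj)
    (Submonoid.closure_mono hsub hy)
  exact ⟨(e, ⟨r, hr⟩), map_normalForm π _ _ _ _ _ _⟩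

lemma definingIdeal_eq_ker_aeval (g : Fin n → ℕ) :
    definingIdeal k g =
      RingHom.ker (aeval (R := k) fun i => (Polynomial.X : Polynomial k) ^ g i) := by
  have hcomp : (aeval (R := k) fun i => (Polynomial.X : Polynomial k) ^ g i) =
      (semigroupRing k g).val.comp (aeval (semigroupRing.gen k g)) := by
    ext i
    simp [semigroupRing.gen]
  ext f
  simp [definingIdeal, RingHom.mem_ker, hcomp]

/-- A common divisor of `a` and `b` divides `α`, hence every generator. -/
lemma coprime_of_forall_eq {H : AddSubmonoid ℕ} (hH : IsNumericalSemigroup H) {g : Fin n → ℕ}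
    (hgen : IsMinimalGeneratingSystem H g) {a b α s : ℕ} (hb : b = α + s * a)
    (hg : ∀ i : Fin n, g i =
      if i.val = 0 then a else if i.val = 1 then b else ℓ * b + (i.val - 1) * α) :
    Nat.Coprime a b := by
  refine hH.eq_one_of_dvd fun x hx => ?_
  have hda := Nat.gcd_dvd_left a b
  have hdb := Nat.gcd_dvd_right a b
  have hdα : a.gcd b ∣ α := by
    refine (Nat.dvd_add_left (hda.mul_left s)).1 ?_
    rwa [← hb]
  rw [← hgen.2.prop] at hx
  induction hx using AddSubmonoid.closure_induction with
  | mem x hx =>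
    obtain ⟨i, rfl⟩ := hx
    rw [hg]
    split_ifs
    · exact hda
    · exact hdb
    · exact (hdb.mul_left _).add (hdα.mul_left _)
  | zero => exact dvd_zero _
  | add x y _ _ hx hy => exact hx.add hy

/-- The defining ideal of a semigroup generated by `a = ℓ + n - 1`, `b = α + q a` and
`ℓ b + i α` for `1 ≤ i ≤ n - 2`. -/
lemma definingIdeal_eq_idealOfMinorsTwo (hn : 3 ≤ n) (hℓ : 0 < ℓ) {a b α : ℕ}
    (ha : a = ℓ + (n - 1)) (hb : b = α + q * a) (hab : Nat.Coprime a b) {g : Fin n → ℕ}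
    (hg : ∀ i : Fin n, g i =
      if i.val = 0 then a else if i.val = 1 then b else ℓ * b + (i.val - 1) * α) :
    definingIdeal k g = idealOfMinorsTwo (stretchedMatrix k n q ℓ (q * ℓ + α)) := by
  rw [definingIdeal_eq_ker_aeval]
  set φ := aeval (R := k) fun i => (Polynomial.X : Polynomial k) ^ g i with hφ
  have hφ0 : φ (X ⟨0, by omega⟩) = Polynomial.X ^ a := by simp [hφ, hg]
  have hφ1 : φ (X ⟨1, by omega⟩) = Polynomial.X ^ b := by simp [hφ, hg]
  have hφu : ∀ i ≤ n - 1, φ (stretchedEntry k n ℓ (q * ℓ + α) hn i) =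
      Polynomial.X ^ (ℓ * b + i * α) := by
    intro i hi
    unfold stretchedEntry
    split_ifs with h0 h1
    · rw [map_pow, hφ1, h0, ← pow_mul]
      ring_nf
    · simp [hφ, hg, h0]
    -- The last entry `X₁ ^ p` fits the progression: `a (q ℓ + α) = ℓ b + (n - 1) α`, because `a = ℓ
    -- + (n - 1)` and `b = α + q a`.
    · rw [map_pow, hφ0, ← pow_mul]
      congr 1
      obtain rfl : i = n - 1 := by omega
      rw [hb, ha]
      ring
  refine ker_eq_of_span_eq_top φ ?_ _ (d := fun s : ℕ × Fin (ℓ + (n - 1)) =>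
    a * s.1 + if s.2.val < ℓ then b * s.2.val else ℓ * b + (s.2.val - ℓ) * α) ?_ ?_
    (top_le_span_normalForm hn hℓ)
  · have hrow : ∀ i : Fin n, φ (stretchedMatrix k n q ℓ (q * ℓ + α) 1 i) =
        Polynomial.X ^ α * φ (stretchedMatrix k n q ℓ (q * ℓ + α) 0 i) := by
      intro i
      rw [stretchedMatrix_one_apply hn, stretchedMatrix_zero_apply hn]
      split_ifs with h0
      · rw [hφ1, map_pow, hφ0, hb, ← pow_mul, ← pow_add, mul_comm a]
      · rw [hφu _ (by omega), hφu _ (by omega), ← pow_add]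
        congr 1
        obtain ⟨j, hj⟩ : ∃ j, i.val = j + 1 := ⟨i.val - 1, by omega⟩
        rw [hj, Nat.add_sub_cancel]
        ring
    rw [idealOfMinorsTwo, Ideal.span_le]
    rintro _ ⟨i, j, -, rfl⟩
    simp only [SetLike.mem_coe, RingHom.mem_ker, Matrix.det_fin_two, Matrix.submatrix_apply, id,
      Matrix.cons_val_zero, Matrix.cons_val_one, map_sub, map_mul, hrow]
    ring
  -- Since `α ≡ b`, the degree of the normal form `(e, r)` is `b r` modulo `a`. As `r < a` and `b`
  -- is coprime to `a`, the degree determines `r`, and then `e`.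
  · have hmod : ∀ s : ℕ × Fin (ℓ + (n - 1)),
        (a * s.1 + if s.2.val < ℓ then b * s.2.val else ℓ * b + (s.2.val - ℓ) * α) ≡
          b * s.2.val [MOD a] := by
      intro s
      have hbα : α ≡ b [MOD a] := by simp [hb, Nat.ModEq]
      refine (show _ ≡ (if s.2.val < ℓ then b * s.2.val else ℓ * b + (s.2.val - ℓ) * α) [MOD a]
        by simp [Nat.ModEq]).trans ?_
      split_ifs with h
      · rfl
      · calc ℓ * b + (s.2.val - ℓ) * α ≡ ℓ * b + (s.2.val - ℓ) * b [MOD a] :=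
              (hbα.mul_left _).add_left _
          _ = b * s.2.val := by rw [← add_mul, Nat.add_sub_cancel' (by omega), mul_comm]
    rintro ⟨e, r⟩ ⟨e', r'⟩ h
    have hr : r = r' := by
      have h1 := (hmod (e, r)).symm.trans ((congrArg (· % a) h : _ ≡ _ [MOD a]).trans
        (hmod (e', r')))
      have h2 := Nat.ModEq.cancel_left_of_coprime hab h1
      exact Fin.ext (h2.eq_of_lt_of_lt (by omega) (by omega))
    subst hr
    simp only [Nat.add_right_cancel_iff] at h
    rw [Nat.eq_of_mul_eq_mul_left (by omega) h]
  · rintro ⟨e, r⟩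
    rw [map_normalForm, normalForm, hφ0, hφ1, ← pow_mul, pow_add]
    congr 1
    split_ifs with h
    · rw [← pow_mul]
    · exact hφu _ (by omega)

end Minors

theorem theorem3p6 (k : Type*) [Field k] (n : ℕ) (hn : 3 ≤ n)
    (H : AddSubmonoid ℕ) (hH : IsNumericalSemigroup H)
    (ℓ h α a b : ℕ) (hℓ : 2 ≤ ℓ) (hα : 0 < α)
    (ha : a = ℓ + n - 1) (hb : ℓ * b = h + α + a)
    (g : Fin n → ℕ)
    (hg : ∀ i : Fin n, g i =
      if i.val = 0 then a else if i.val = 1 then b else h + i.val * α + a)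
    (hgen : IsMinimalGeneratingSystem H g)
    (hmult : IsMultiplicity H a)
    (hstr : IsStretchedArtinianLocal
      (semigroupRing k g ⧸ Ideal.span {semigroupRing.gen k g ⟨0, by omega⟩}))
    (hPF : pseudoFrobenius H =
      {x : ℤ | ∃ i : ℕ, 1 ≤ i ∧ i ≤ n - 1 ∧ x = (h : ℤ) + (i : ℤ) * (α : ℤ)}) :
    (h : ℤ) - ((ℓ : ℤ) - 1) * (b : ℤ) ≡ 0 [ZMOD (a : ℤ)] ∧
    ∃ h₁ : ℕ, h = h₁ * a + (ℓ - 1) * b ∧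
      definingIdeal k g =
        idealOfMinorsTwo (stretchedMatrix k n (h₁ + 1) ℓ ((h₁ + 1) * ℓ + α)) := by

  obtain ⟨q, hq⟩ := exists_eq_add_mul_of_pseudoFrobenius hn hH hℓ hα (by omega) hb hg hgen hPF
  obtain ⟨m, rfl⟩ : ∃ m, ℓ = m + 1 := ⟨ℓ - 1, by omega⟩
  have hh : h = q * a + m * b := by
    have h1 : (m + 1) * b = m * b + b := by ring
    have h2 : (q + 1) * a = q * a + a := by ring
    omega
  have hg' : ∀ i : Fin n, g i =
      if i.val = 0 then a else if i.val = 1 then b else (m + 1) * b + (i.val - 1) * α := by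
    intro i
    rw [hg]
    split_ifs with h0 h1
    · rfl
    · rfl
    · obtain ⟨j, hj⟩ : ∃ j, i.val = j + 1 := ⟨i.val - 1, by omega⟩
      rw [hj, hb, Nat.add_sub_cancel]
      ring
  refine ⟨?_, q, by simpa using hh, ?_⟩
  · refine (Int.modEq_zero_iff_dvd).2 ⟨q, ?_⟩
    rw [hh]
    push_cast
    ring
  · exact definingIdeal_eq_idealOfMinorsTwo hn (by omega) (by omega) hq
      (coprime_of_forall_eq hH hgen hq hg') hg'
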